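/- Let $(\mathbb{X}, |\cdot|)$ be a (real or complex) Banach space, and let $f : \mathbb{R} \to \mathbb{X}$ be Bohr-almost periodic, that is, $f$ is continuous and, for every $\varepsilon > 0$, the set $$\mathcal{P}_\varepsilon = \Bigl\{ t \in \mathbb{R} : \sup_{x \in \mathbb{R}} |f(x) - f(x-t)| < \varepsilon \Bigr\}$$ is relatively dense in $\mathbb{R}$ (for some $L > 0$, it meets every interval $[a, a+L]$ with $a \in \mathbb{R}$). Then the mean $$M(f) = \lim_{T \to \infty} \frac{1}{2T} \int_{a-T}^{a+T} f(x) \, dx \in \mathbb{X},$$ with the integral taken in the sense of Bochner, exists for every $a \in \mathbb{R}$, is independent of $a$, and the convergence is uniform in $a$. Moreover, for every fixed $\alpha \in \mathbb{R}$ with $|\alpha| > 1$, one has $$\lim_{N \to \infty} \frac{1}{N} \sum_{n=0}^{N-1} f(\alpha^n x) = M(f)$$ in the norm of $\mathbb{X}$, for Lebesgue-almost every $x \in \mathbb{R}$. -/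

import Mathlib

open Filter Topology MeasureTheory
open scoped ENNReal

/-- The supremum norm `‖f‖_∞ = sup_x |f x|`, with values in `[0, ∞]`
(so it is `∞` for an unbounded function). -/
noncomputable def supNorm {X : Type*} [NormedAddCommGroup X] (f : ℝ → X) : ℝ≥0∞ :=
  ⨆ x : ℝ, ‖f x‖ₑ

/-- The set of `ε`-almost periods of `f`: all `t` with `‖f - T_t f‖_∞ < ε`,
where `(T_t f) x = f (x - t)` is the translate of `f`. -/
def almostPeriods {X : Type*} [NormedAddCommGroup X] (f : ℝ → X) (ε : ℝ) : Set ℝ :=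
  {t : ℝ | supNorm (f - translate t f) < ENNReal.ofReal ε}

/-- A subset of the real line is relatively dense if, for some `L > 0`, it meets every
interval `[a, a + L]`. -/
def IsRelativelyDense (S : Set ℝ) : Prop :=
  ∃ L : ℝ, 0 < L ∧ ∀ a : ℝ, (S ∩ Set.Icc a (a + L)).Nonempty

/-- A function on the real line is Bohr-almost periodic if it is continuous and, for every
`ε > 0`, its set of `ε`-almost periods is relatively dense. -/
def IsBohrAlmostPeriodic {X : Type*} [NormedAddCommGroup X] (f : ℝ → X) : Prop :=
  Continuous f ∧ ∀ ε : ℝ, 0 < ε → IsRelativelyDense (almostPeriods f ε)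

/-- `m` is the mean of `f`: the averages `(1 / 2T) ∫_{a-T}^{a+T} f(x) dx` (Bochner integrals of
a locally integrable function) converge to `m` as `T → ∞`, for all `a` and uniformly in `a`. -/
def HasMean {X : Type*} [NormedAddCommGroup X] [NormedSpace ℝ X] (f : ℝ → X) (m : X) : Prop :=
  LocallyIntegrable f volume ∧
    TendstoUniformly (fun (T a : ℝ) => (1 / (2 * T)) • ∫ x in (a - T)..(a + T), f x)
      (fun _ : ℝ => m) atTop

/-! ### Basic properties of Bohr-almost periodic functions. -/

section AlmostPeriodic

variable {X Y : Type*} [NormedAddCommGroup X] [NormedAddCommGroup Y]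

/-! Write `A_T` for the average over the window of radius `T`. For large `T`, `A_T f` is nearly
constant: almost periods bring any point near any other. Since `A_S` and `A_T` commute, `A_S (A_T
f)` is close to both `A_S f` and `A_T f`, so the averages are Cauchy, uniformly in the centre.

For the pointwise limit with real `f`, approximate `f - m` uniformly by `q = A_d (f - A_T f)`, which
has a bounded primitive and a bounded derivative. Integration by parts makes the correlations of `q
(α ^ n * x)` decay geometrically, so the second moments of their sums grow linearly, and summation
along squares gives almost sure convergence. No trigonometric polynomials are needed.

For vector values, the range is totally bounded, and a partition of unity reduces the claim to
finitely many real coefficients at each precision. -/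

lemma norm_sub_lt_of_mem_almostPeriods {f : ℝ → X} {ε t : ℝ} (ht : t ∈ almostPeriods f ε) (x : ℝ) :
    ‖f x - f (x - t)‖ < ε := by
  have h : ‖f x - f (x - t)‖ₑ < ENNReal.ofReal ε :=
    (le_iSup (fun x => ‖(f - translate t f) x‖ₑ) x).trans_lt ht
  rw [← ofReal_norm] at h
  exact (ENNReal.ofReal_lt_ofReal_iff_of_nonneg (norm_nonneg _)).1 h

lemma mem_almostPeriods_of_forall_norm_sub_le {f : ℝ → X} {ε δ t : ℝ} (hδ : 0 < ε) (hδε : δ < ε)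
    (h : ∀ x, ‖f x - f (x - t)‖ ≤ δ) : t ∈ almostPeriods f ε := by
  refine lt_of_le_of_lt (iSup_le fun x => ?_) ((ENNReal.ofReal_lt_ofReal_iff hδ).2 hδε)
  rw [← ofReal_norm]
  exact ENNReal.ofReal_le_ofReal (h x)

namespace IsBohrAlmostPeriodic

variable {f : ℝ → X}

/-- Every interval of length `L` contains an `ε`-almost period, stated as: any point `x` can be
moved by an `ε`-almost period into `[b, b + L]`. -/
lemma exists_shift (hf : IsBohrAlmostPeriodic f) {ε : ℝ} (hε : 0 < ε) :
    ∃ L : ℝ, 0 < L ∧ ∀ x b : ℝ, ∃ t : ℝ, (∀ y, ‖f y - f (y - t)‖ < ε) ∧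
      x - t ∈ Set.Icc b (b + L) := by
  obtain ⟨L, hL, h⟩ := hf.2 ε hε
  refine ⟨L, hL, fun x b => ?_⟩
  obtain ⟨t, ht, h1, h2⟩ := h (x - b - L)
  exact ⟨t, norm_sub_lt_of_mem_almostPeriods ht, by linarith, by linarith⟩

lemma totallyBounded_range (hf : IsBohrAlmostPeriodic f) : TotallyBounded (Set.range f) := by
  rw [Metric.totallyBounded_iff]
  intro ε hε
  obtain ⟨L, -, hL⟩ := hf.exists_shift (half_pos hε)
  have hc : TotallyBounded (f '' Set.Icc 0 (0 + L)) := (isCompact_Icc.image hf.1).totallyBounded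
  obtain ⟨t, ht, hcov⟩ := Metric.totallyBounded_iff.1 hc (ε / 2) (half_pos hε)
  refine ⟨t, ht, ?_⟩
  rintro _ ⟨x, rfl⟩
  obtain ⟨s, hs, hxs⟩ := hL x 0
  obtain ⟨c, hct, hc⟩ := Set.mem_iUnion₂.1 (hcov ⟨x - s, hxs, rfl⟩)
  refine Set.mem_iUnion₂.2 ⟨c, hct, ?_⟩
  have h1 := hs x
  rw [← dist_eq_norm] at h1
  have h2 := dist_triangle (f x) (f (x - s)) c
  rw [Metric.mem_ball] at hc ⊢
  linarith

lemma exists_norm_le (hf : IsBohrAlmostPeriodic f) : ∃ M : ℝ, 0 < M ∧ ∀ x, ‖f x‖ ≤ M := by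
  obtain ⟨M, hM, h⟩ := hf.totallyBounded_range.isBounded.exists_pos_norm_le
  exact ⟨M, hM, fun x => h _ ⟨x, rfl⟩⟩

lemma uniformContinuous (hf : IsBohrAlmostPeriodic f) : UniformContinuous f := by
  rw [Metric.uniformContinuous_iff]
  intro ε hε
  obtain ⟨L, hL0, hL⟩ := hf.exists_shift (show 0 < ε / 3 by positivity)
  -- The margin of 1 on each side keeps `y - s` in the compact interval when `x - s` lies in `[0,
  -- L]`.
  have hc := (isCompact_Icc (a := -1) (b := L + 1)).uniformContinuousOn_of_continuous
    hf.1.continuousOn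
  obtain ⟨δ, hδ, h⟩ := Metric.uniformContinuousOn_iff.1 hc (ε / 3) (by positivity)
  refine ⟨min δ 1, lt_min hδ one_pos, fun {x y} hxy => ?_⟩
  obtain ⟨s, hs, h1, h2⟩ := hL x 0
  have hxy1 : |x - y| < 1 := hxy.trans_le (min_le_right _ _)
  rw [abs_lt] at hxy1
  have h3 : dist (f (x - s)) (f (y - s)) < ε / 3 := by
    refine h _ ⟨by linarith, by linarith⟩ _ ⟨by linarith, by linarith⟩ ?_
    rw [dist_sub_right]
    exact hxy.trans_le (min_le_left _ _)
  have h4 := hs x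
  have h5 := hs y
  rw [← dist_eq_norm] at h4 h5
  have h6 := dist_triangle4_right (f x) (f y) (f (x - s)) (f (y - s))
  linarith

lemma comp (hf : IsBohrAlmostPeriodic f) {h : X → Y} (hh : UniformContinuousOn h (Set.range f)) :
    IsBohrAlmostPeriodic (fun x => h (f x)) := by
  refine ⟨hh.continuousOn.comp_continuous hf.1 fun x => ⟨x, rfl⟩, fun ε hε => ?_⟩
  obtain ⟨δ, hδ, H⟩ := Metric.uniformContinuousOn_iff.1 hh (ε / 2) (half_pos hε)
  obtain ⟨L, hL0, hL⟩ := hf.2 δ hδ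
  refine ⟨L, hL0, fun a => (hL a).mono (Set.inter_subset_inter_left _ fun t ht => ?_)⟩
  refine mem_almostPeriods_of_forall_norm_sub_le hε (half_lt_self hε) fun x => ?_
  rw [← dist_eq_norm]
  refine (H _ ⟨x, rfl⟩ _ ⟨x - t, rfl⟩ ?_).le
  rw [dist_eq_norm]
  exact norm_sub_lt_of_mem_almostPeriods ht x

end IsBohrAlmostPeriodic

end AlmostPeriodic

/-! ### Steklov averages. -/

section Steklov

variable {X : Type*} [NormedAddCommGroup X] [NormedSpace ℝ X]

/-- The Steklov average of `f` over the interval of radius `T` centred at `x`. -/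
noncomputable def steklovAverage (T : ℝ) (f : ℝ → X) (x : ℝ) : X :=
  (1 / (2 * T)) • ∫ t in (x - T)..(x + T), f t

lemma Continuous.exists_hasDerivAt [CompleteSpace X] {f : ℝ → X} (hf : Continuous f) :
    ∃ F : ℝ → X, ∀ x, HasDerivAt F (f x) x :=
  ⟨fun x => ∫ t in (0 : ℝ)..x, f t, fun _ => intervalIntegral.integral_hasDerivAt_right
    (hf.intervalIntegrable _ _) hf.stronglyMeasurable.stronglyMeasurableAtFilter hf.continuousAt⟩

lemma continuous_of_forall_hasDerivAt {f f' : ℝ → X} (h : ∀ x, HasDerivAt f (f' x) x) :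
    Continuous f :=
  continuous_iff_continuousAt.2 fun x => (h x).continuousAt

lemma norm_sub_le_of_forall_hasDerivAt {f f' : ℝ → X} {C a b : ℝ} (h : ∀ x, HasDerivAt f (f' x) x)
    (hC : ∀ x ∈ Set.Icc a b, ‖f' x‖ ≤ C) (hab : a ≤ b) : ‖f b - f a‖ ≤ C * (b - a) :=
  norm_image_sub_le_of_norm_deriv_le_segment' (fun x _ => (h x).hasDerivWithinAt)
    (fun x hx => hC x (Set.Ico_subset_Icc_self hx)) b (Set.right_mem_Icc.2 hab)

variable {f F : ℝ → X} {T : ℝ}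

lemma steklovAverage_eq [CompleteSpace X] (hf : Continuous f) (hF : ∀ x, HasDerivAt F (f x) x)
    (x : ℝ) : steklovAverage T f x = (1 / (2 * T)) • (F (x + T) - F (x - T)) := by
  rw [steklovAverage, intervalIntegral.integral_eq_sub_of_hasDerivAt (fun y _ => hF y)
    (hf.intervalIntegrable _ _)]

lemma hasDerivAt_symmetric_difference (hF : ∀ x, HasDerivAt F (f x) x) (x : ℝ) :
    HasDerivAt (fun x => (1 / (2 * T)) • (F (x + T) - F (x - T)))
      ((1 / (2 * T)) • (f (x + T) - f (x - T))) x :=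
  (((hF _).comp_add_const x T).sub ((hF _).comp_sub_const x T)).const_smul _

lemma hasDerivAt_steklovAverage [CompleteSpace X] (hf : Continuous f) (x : ℝ) :
    HasDerivAt (steklovAverage T f) ((1 / (2 * T)) • (f (x + T) - f (x - T))) x := by
  obtain ⟨F, hF⟩ := hf.exists_hasDerivAt
  rw [show steklovAverage T f = _ from funext fun y => steklovAverage_eq hf hF y]
  exact hasDerivAt_symmetric_difference hF x

lemma hasDerivAt_steklovAverage_of_hasDerivAt [CompleteSpace X] (hf : Continuous f)
    (hF : ∀ x, HasDerivAt F (f x) x) (x : ℝ) :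
    HasDerivAt (steklovAverage T F) (steklovAverage T f x) x := by
  rw [steklovAverage_eq hf hF]
  exact hasDerivAt_steklovAverage (continuous_of_forall_hasDerivAt hF) x

lemma norm_smul_sub_le {M : ℝ} (hT : 0 < T) (hM : ∀ x, ‖f x‖ ≤ M) (a b : ℝ) :
    ‖(1 / (2 * T)) • (f a - f b)‖ ≤ M / T := by
  rw [norm_smul, Real.norm_of_nonneg (by positivity)]
  have := (norm_sub_le (f a) (f b)).trans (add_le_add (hM a) (hM b))
  calc 1 / (2 * T) * ‖f a - f b‖ ≤ 1 / (2 * T) * (M + M) := by gcongr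
    _ = M / T := by field_simp; ring

lemma norm_steklovAverage_sub_le [CompleteSpace X] {c : X} {r x : ℝ} (hf : Continuous f)
    (hT : 0 < T) (h : ∀ t ∈ Set.Icc (x - T) (x + T), ‖f t - c‖ ≤ r) :
    ‖steklovAverage T f x - c‖ ≤ r := by
  obtain ⟨F, hF⟩ := hf.exists_hasDerivAt
  have h1 := norm_sub_le_of_forall_hasDerivAt (f := fun t => F t - t • c) (f' := fun t => f t - c)
    (a := x - T) (b := x + T) (fun t => by
      simpa using! (hF t).sub ((hasDerivAt_id t).smul_const c)) h (by linarith)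
  rw [steklovAverage_eq hf hF]
  have h2 : (1 / (2 * T)) • (F (x + T) - F (x - T)) - c
      = (1 / (2 * T)) • (F (x + T) - (x + T) • c - (F (x - T) - (x - T) • c)) := by
    have : c = (1 / (2 * T)) • (((x + T) - (x - T)) • c) := by
      rw [smul_smul, show 1 / (2 * T) * (x + T - (x - T)) = 1 by field_simp; ring, one_smul]
    nth_rewrite 1 [this]
    module
  rw [h2, norm_smul, Real.norm_of_nonneg (by positivity)]
  calc _ ≤ 1 / (2 * T) * (r * (x + T - (x - T))) := by gcongr
    _ = r := by field_simp; ring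

lemma norm_steklovAverage_le [CompleteSpace X] {M : ℝ} (hf : Continuous f)
    (hT : 0 < T) (h : ∀ t, ‖f t‖ ≤ M) (x : ℝ) : ‖steklovAverage T f x‖ ≤ M := by
  simpa using norm_steklovAverage_sub_le (c := 0) (x := x) hf hT (by simpa using fun t _ _ => h t)

/-- The operators `steklovAverage S` and `steklovAverage T` commute. -/
lemma steklovAverage_comm [CompleteSpace X] (hf : Continuous f) (S T x : ℝ) :
    steklovAverage S (steklovAverage T f) x = steklovAverage T (steklovAverage S f) x := by
  obtain ⟨F, hF⟩ := hf.exists_hasDerivAt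
  have hFc := continuous_of_forall_hasDerivAt hF
  obtain ⟨H, hH⟩ := hFc.exists_hasDerivAt
  have hc (T : ℝ) : Continuous (steklovAverage T f) :=
    continuous_of_forall_hasDerivAt fun x => hasDerivAt_steklovAverage hf x
  have hd (T : ℝ) := hasDerivAt_steklovAverage_of_hasDerivAt (T := T) hf hF
  -- With `H` a second primitive of `f`, both sides become the same second difference of `H`; no
  -- Fubini argument is needed.
  rw [steklovAverage_eq (hc T) (hd T), steklovAverage_eq (hc S) (hd S)]
  simp only [steklovAverage_eq hFc hH]
  rw [show x + T + S = x + S + T by ring, show x + T - S = x - S + T by ring,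
    show x - T + S = x + S - T by ring, show x - T - S = x - S - T by ring]
  module

end Steklov

/-! ### Existence of the mean. -/

section Mean

variable {X : Type*} [NormedAddCommGroup X] [NormedSpace ℝ X] [CompleteSpace X] {f : ℝ → X}

/-- An almost period moves `a` to within `L` of `b` at cost `ε / 2`; over the remaining distance the
average is `M / T`-Lipschitz. -/
lemma IsBohrAlmostPeriodic.eventually_norm_steklovAverage_sub_le (hf : IsBohrAlmostPeriodic f)
    {ε : ℝ} (hε : 0 < ε) :
    ∀ᶠ T : ℝ in atTop, ∀ a b, ‖steklovAverage T f a - steklovAverage T f b‖ ≤ ε := by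
  obtain ⟨M, hM0, hM⟩ := hf.exists_norm_le
  obtain ⟨L, hL0, hL⟩ := hf.exists_shift (half_pos hε)
  filter_upwards [eventually_gt_atTop 0, eventually_ge_atTop (2 * M * L / ε)] with T hT hT' a b
  obtain ⟨t, ht, h1, h2⟩ := hL a b
  have hshift : Continuous fun y => f y - f (y - t) := by have := hf.1; fun_prop
  have e1 : ‖steklovAverage T f a - steklovAverage T f (a - t)‖ ≤ ε / 2 := by
    have : steklovAverage T f a - steklovAverage T f (a - t)
        = steklovAverage T (fun y => f y - f (y - t)) a := by
      simp only [steklovAverage]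
      rw [intervalIntegral.integral_sub (hf.1.intervalIntegrable _ _)
        ((by have := hf.1; fun_prop : Continuous fun y => f (y - t)).intervalIntegrable _ _),
        intervalIntegral.integral_comp_sub_right, smul_sub]
      congr 3 <;> ring
    rw [this]
    exact norm_steklovAverage_le hshift hT (fun y => (ht y).le) a
  have e2 : ‖steklovAverage T f (a - t) - steklovAverage T f b‖ ≤ ε / 2 := by
    refine (norm_sub_le_of_forall_hasDerivAt (fun x => hasDerivAt_steklovAverage hf.1 x)
      (fun x _ => norm_smul_sub_le hT hM _ _) h1).trans ?_
    rw [div_le_iff₀ hε] at hT'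
    calc M / T * (a - t - b) ≤ M / T * L := by gcongr; linarith
      _ ≤ ε / 2 := by rw [div_mul_eq_mul_div, div_le_iff₀ hT]; linarith
  calc _ ≤ _ := norm_sub_le_norm_sub_add_norm_sub _ (steklovAverage T f (a - t)) _
    _ ≤ ε := by linarith

theorem IsBohrAlmostPeriodic.exists_hasMean (hf : IsBohrAlmostPeriodic f) :
    ∃ m : X, HasMean f m := by
  have key : ∀ ε : ℝ, 0 < ε → ∃ N : ℝ, ∀ T ≥ N, ∀ S ≥ N, ∀ a b,
      ‖steklovAverage T f a - steklovAverage S f b‖ ≤ ε := by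
    intro ε hε
    obtain ⟨N, hN⟩ := eventually_atTop.1 ((eventually_gt_atTop (0 : ℝ)).and
      (hf.eventually_norm_steklovAverage_sub_le (half_pos hε)))
    have hc (T : ℝ) : Continuous (steklovAverage T f) :=
      continuous_of_forall_hasDerivAt fun x => hasDerivAt_steklovAverage hf.1 x
    -- An average of values of `A_S f`, all within `ε / 2` of `A_S f a`, stays that close;
    -- commutation then lets `S` and `T` swap roles.
    have h (T S : ℝ) (hT : T ≥ N) (hS : S ≥ N) (a : ℝ) :
        ‖steklovAverage T (steklovAverage S f) 0 - steklovAverage S f a‖ ≤ ε / 2 :=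
      norm_steklovAverage_sub_le (hc S) (hN T hT).1 fun t _ => (hN S hS).2 t a
    refine ⟨N, fun T hT S hS a b => ?_⟩
    have h1 := h T S hT hS b
    have h2 := h S T hS hT a
    rw [steklovAverage_comm hf.1, norm_sub_rev] at h2
    calc _ ≤ _ := norm_sub_le_norm_sub_add_norm_sub _
          (steklovAverage T (steklovAverage S f) 0) _
      _ ≤ ε := by linarith
  have hcau : Cauchy (map (fun T => steklovAverage T f 0) atTop) := by
    refine Metric.cauchy_iff.2 ⟨inferInstance, fun ε hε => ?_⟩
    obtain ⟨N, hN⟩ := key (ε / 2) (half_pos hε)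
    refine ⟨_, image_mem_map (Ici_mem_atTop N), ?_⟩
    rintro _ ⟨T, hT, rfl⟩ _ ⟨S, hS, rfl⟩
    rw [dist_eq_norm]
    exact (hN T hT S hS 0 0).trans_lt (half_lt_self hε)
  obtain ⟨m, hm⟩ := CompleteSpace.complete hcau
  refine ⟨m, hf.1.locallyIntegrable, Metric.tendstoUniformly_iff.2 fun ε hε => ?_⟩
  obtain ⟨N, hN⟩ := key (ε / 2) (half_pos hε)
  filter_upwards [eventually_ge_atTop N] with T hT a
  rw [dist_eq_norm]
  refine lt_of_le_of_lt ?_ (half_lt_self hε)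
  refine le_of_tendsto ((Tendsto.sub_const hm _).norm) ?_
  filter_upwards [eventually_ge_atTop N] with S hS using hN S hS T hT 0 a

end Mean

/-! ### Decay of correlations and second moments. -/

section BoundedJet

/-- `Q' = q` and `q' = r`, where `r` is continuous and `Q`, `q`, `r` are bounded by `C`. -/
structure HasBoundedJet (Q q r : ℝ → ℝ) (C : ℝ) : Prop where
  hasDerivAt_primitive : ∀ x, HasDerivAt Q (q x) x
  hasDerivAt : ∀ x, HasDerivAt q (r x) x
  continuous_deriv : Continuous r
  abs_primitive_le : ∀ x, |Q x| ≤ C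
  abs_apply_le : ∀ x, |q x| ≤ C
  abs_deriv_le : ∀ x, |r x| ≤ C

namespace HasBoundedJet

variable {Q q r : ℝ → ℝ} {C : ℝ}

lemma continuous (h : HasBoundedJet Q q r C) : Continuous q :=
  continuous_of_forall_hasDerivAt h.hasDerivAt

lemma nonneg (h : HasBoundedJet Q q r C) : 0 ≤ C := (abs_nonneg _).trans (h.abs_apply_le 0)

/-- Decay of correlations between the dilates `x ↦ q (β x)` and `x ↦ q (γ x)`. -/
lemma abs_integral_mul_le (h : HasBoundedJet Q q r C) {β γ a b : ℝ} (hβ : β ≠ 0) (hγ : 1 ≤ |γ|)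
    (hab : a ≤ b) :
    |∫ x in a..b, q (β * x) * q (γ * x)| ≤ C ^ 2 * (2 + (b - a)) * |γ / β| := by
  have hC := h.nonneg
  have hqc := h.continuous
  have hrc := h.continuous_deriv
  have hQc := continuous_of_forall_hasDerivAt h.hasDerivAt_primitive
  have hβ' : 0 < |β| := abs_pos.2 hβ
  have hu (x : ℝ) : HasDerivAt (fun x => Q (β * x) / β) (q (β * x)) x := by
    have := ((h.hasDerivAt_primitive (β * x)).comp x ((hasDerivAt_id x).const_mul β)).div_const β
    simpa [hβ] using! this
  have hv (x : ℝ) : HasDerivAt (fun x => q (γ * x)) (γ * r (γ * x)) x := by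
    have := (h.hasDerivAt (γ * x)).comp x ((hasDerivAt_id x).const_mul γ)
    simpa [mul_comm] using! this
  -- Integrating `q (β * x)` gains `1 / β`; differentiating `q (γ * x)` costs only `γ`.
  have key := intervalIntegral.integral_deriv_mul_eq_sub (a := a) (b := b) (fun x _ => hu x)
    (fun x _ => hv x) ((by fun_prop : Continuous fun x => q (β * x)).intervalIntegrable _ _)
    ((by fun_prop : Continuous fun x => γ * r (γ * x)).intervalIntegrable _ _)
  rw [intervalIntegral.integral_add
    ((by fun_prop : Continuous fun x => q (β * x) * q (γ * x)).intervalIntegrable _ _)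
    ((by fun_prop : Continuous fun x => Q (β * x) / β * (γ * r (γ * x))).intervalIntegrable _ _)]
    at key
  have hbd (x : ℝ) : |Q (β * x) / β * q (γ * x)| ≤ C ^ 2 * |γ / β| := by
    rw [abs_mul, abs_div, abs_div]
    calc |Q (β * x)| / |β| * |q (γ * x)| ≤ C / |β| * C := by
          gcongr
          · exact h.abs_primitive_le _
          · exact h.abs_apply_le _
      _ = C ^ 2 * (1 / |β|) := by ring
      -- Here `1 ≤ |γ|` lets the boundary terms share the bound of the integral.
      _ ≤ C ^ 2 * (|γ| / |β|) := by gcongr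
  have hint : ‖∫ x in a..b, Q (β * x) / β * (γ * r (γ * x))‖ ≤ C ^ 2 * |γ / β| * (b - a) := by
    rw [← abs_of_nonneg (sub_nonneg.2 hab)]
    refine intervalIntegral.norm_integral_le_of_norm_le_const fun x _ => ?_
    rw [Real.norm_eq_abs, abs_mul, abs_mul, abs_div, abs_div]
    calc |Q (β * x)| / |β| * (|γ| * |r (γ * x)|) ≤ C / |β| * (|γ| * C) := by
          gcongr
          · exact h.abs_primitive_le _
          · exact h.abs_deriv_le _
      _ = C ^ 2 * (|γ| / |β|) := by ring
  have h1 := abs_le.1 (hbd a)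
  have h2 := abs_le.1 (hbd b)
  have h3 := abs_le.1 hint
  rw [show C ^ 2 * (2 + (b - a)) * |γ / β|
    = 2 * (C ^ 2 * |γ / β|) + C ^ 2 * |γ / β| * (b - a) by ring]
  exact abs_le.2 ⟨by linarith [h1.1, h1.2, h2.1, h2.2, h3.1, h3.2],
    by linarith [h1.1, h1.2, h2.1, h2.2, h3.1, h3.2]⟩

lemma integral_sum_sq_le (h : HasBoundedJet Q q r C) {α a b : ℝ} (hα : 1 < |α|) (hab : a ≤ b)
    (N : ℕ) :
    ∫ x in a..b, (∑ n ∈ Finset.range N, q (α ^ n * x)) ^ 2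
      ≤ 2 * (C ^ 2 * (2 + (b - a))) * (1 - |α|⁻¹)⁻¹ * N := by
  have hqc := h.continuous
  have hα0 : α ≠ 0 := by rintro rfl; simp at hα; linarith
  have hρ0 : 0 ≤ |α|⁻¹ := by positivity
  have hρ1 : |α|⁻¹ < 1 := inv_lt_one_of_one_lt₀ hα
  have hK : 0 ≤ C ^ 2 * (2 + (b - a)) := mul_nonneg (sq_nonneg _) (by linarith)
  set K := C ^ 2 * (2 + (b - a))
  induction N with
  | zero => simp
  | succ N ih =>
    have hcor (n : ℕ) (hn : n ∈ Finset.range (N + 1)) :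
        ∫ x in a..b, q (α ^ N * x) * q (α ^ n * x) ≤ K * |α|⁻¹ ^ (N - n) := by
      refine (le_abs_self _).trans ((h.abs_integral_mul_le (pow_ne_zero _ hα0) ?_ hab).trans_eq ?_)
      · rw [abs_pow]
        exact one_le_pow₀ hα.le
      · have hn' : n ≤ N := Nat.lt_succ_iff.1 (Finset.mem_range.1 hn)
        have h0 : |α| ≠ 0 := abs_ne_zero.2 hα0
        rw [abs_div, abs_pow, abs_pow, inv_pow, pow_sub₀ _ h0 hn', mul_inv, inv_inv, div_eq_inv_mul]
    have hgeom : ∑ n ∈ Finset.range (N + 1), |α|⁻¹ ^ (N - n) ≤ (1 - |α|⁻¹)⁻¹ := by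
      have := Finset.sum_range_reflect (fun n => |α|⁻¹ ^ n) (N + 1)
      simp only [Nat.add_sub_cancel] at this
      rw [this, ← tsum_geometric_of_lt_one hρ0 hρ1]
      exact (summable_geometric_of_lt_one hρ0 hρ1).sum_le_tsum _ fun _ _ => by positivity
    -- Including `n = N` in the cross terms counts the new square twice, which only enlarges the
    -- bound and leaves one full geometric sum.
    calc ∫ x in a..b, (∑ n ∈ Finset.range (N + 1), q (α ^ n * x)) ^ 2
        ≤ ∫ x in a..b, ((∑ n ∈ Finset.range N, q (α ^ n * x)) ^ 2 +
            2 * ∑ n ∈ Finset.range (N + 1), q (α ^ N * x) * q (α ^ n * x)) := by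
          refine intervalIntegral.integral_mono_on hab
            (Continuous.intervalIntegrable (by fun_prop) _ _)
            (Continuous.intervalIntegrable (by fun_prop) _ _) fun x _ => ?_
          rw [← Finset.mul_sum, Finset.sum_range_succ]
          nlinarith [sq_nonneg (q (α ^ N * x))]
      _ = (∫ x in a..b, (∑ n ∈ Finset.range N, q (α ^ n * x)) ^ 2) +
            2 * ∑ n ∈ Finset.range (N + 1), ∫ x in a..b, q (α ^ N * x) * q (α ^ n * x) := by
          rw [intervalIntegral.integral_add (Continuous.intervalIntegrable (by fun_prop) _ _)
            (Continuous.intervalIntegrable (by fun_prop) _ _), intervalIntegral.integral_const_mul,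
            intervalIntegral.integral_finsetSum fun n _ =>
              Continuous.intervalIntegrable (by fun_prop) _ _]
      _ ≤ 2 * K * (1 - |α|⁻¹)⁻¹ * N + 2 * (K * (1 - |α|⁻¹)⁻¹) := by
          refine add_le_add ih (mul_le_mul_of_nonneg_left ?_ zero_le_two)
          refine (Finset.sum_le_sum hcor).trans ?_
          rw [← Finset.mul_sum]
          exact mul_le_mul_of_nonneg_left hgeom hK
      _ = 2 * K * (1 - |α|⁻¹)⁻¹ * (N + 1 : ℕ) := by push_cast; ring

end HasBoundedJet

end BoundedJet

/-! ### A strong law of large numbers. -/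

section StrongLaw

/-- Adding `C` to each term makes the partial sums monotone, and ratios of consecutive squares tend
to 1, so the gaps fill in. -/
lemma tendsto_average_of_tendsto_average_sq {u : ℕ → ℝ} {C : ℝ} (hu : ∀ n, |u n| ≤ C)
    (h : Tendsto (fun k : ℕ => (∑ n ∈ Finset.range (k ^ 2), u n) / (k ^ 2 : ℕ)) atTop (𝓝 0)) :
    Tendsto (fun N : ℕ => (∑ n ∈ Finset.range N, u n) / N) atTop (𝓝 0) := by
  have hsum (N : ℕ) (hN : 0 < N) : (∑ n ∈ Finset.range N, (u n + C)) / (N : ℝ)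
      = (∑ n ∈ Finset.range N, u n) / N + C := by
    rw [Finset.sum_add_distrib, Finset.sum_const, Finset.card_range, nsmul_eq_mul]
    field_simp
  have key := tendsto_div_of_monotone_of_exists_subseq_tendsto_div
    (fun N => ∑ n ∈ Finset.range N, (u n + C)) C
    (monotone_nat_of_le_succ fun N => by
      rw [Finset.sum_range_succ]
      linarith [(abs_le.1 (hu N)).1])
    (fun a ha => ⟨fun k => k ^ 2, ?_, tendsto_pow_atTop two_ne_zero, ?_⟩)
  · have := key.sub_const C
    rw [sub_self] at this
    refine this.congr' ?_
    filter_upwards [eventually_gt_atTop 0] with N hN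
    rw [hsum N hN, add_sub_cancel_right]
  · filter_upwards [tendsto_natCast_atTop_atTop.eventually_ge_atTop (3 / (a - 1)),
      eventually_ge_atTop 1] with n hn h1
    have h1' : (1 : ℝ) ≤ n := by exact_mod_cast h1
    rw [div_le_iff₀ (by linarith)] at hn
    push_cast
    nlinarith
  · have := h.add_const C
    rw [zero_add] at this
    refine this.congr' ?_
    filter_upwards [eventually_gt_atTop 0] with k hk
    rw [hsum _ (by positivity)]

/-- A strong law of large numbers for bounded sequences of functions whose partial sums have
second moments of linear growth. -/
lemma ae_tendsto_average_of_integral_sum_sq_le {u : ℕ → ℝ → ℝ} (huc : ∀ n, Continuous (u n))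
    {C D a b : ℝ} (hu : ∀ n x, |u n x| ≤ C) (hab : a ≤ b)
    (hD : ∀ N : ℕ, ∫ x in a..b, (∑ n ∈ Finset.range N, u n x) ^ 2 ≤ D * N) :
    ∀ᵐ x ∂volume.restrict (Set.Ioc a b),
      Tendsto (fun N : ℕ => (∑ n ∈ Finset.range N, u n x) / N) atTop (𝓝 0) := by
  -- The squared average at `N = k ^ 2` has integral at most `D / k ^ 2`, which is summable; hence
  -- the `v k x` are summable for almost every `x`.
  let v (k : ℕ) (x : ℝ) : ℝ := ((∑ n ∈ Finset.range (k ^ 2), u n x) / (k ^ 2 : ℕ)) ^ 2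
  have hv (k : ℕ) : Continuous (v k) := by fun_prop
  have hlin (k : ℕ) : ∫⁻ x in Set.Ioc a b, ENNReal.ofReal (v k x)
      ≤ ENNReal.ofReal (D * (1 / (k : ℝ) ^ 2)) := by
    rw [← ofReal_integral_eq_lintegral_ofReal
      ((hv k).intervalIntegrable a b).1 (Eventually.of_forall fun x => sq_nonneg _),
      ← intervalIntegral.integral_of_le hab]
    refine ENNReal.ofReal_le_ofReal ?_
    simp only [v, div_pow]
    rw [intervalIntegral.integral_div]
    rcases Nat.eq_zero_or_pos k with rfl | hk
    · simp
    · rw [div_le_iff₀ (by positivity)]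
      refine (hD (k ^ 2)).trans_eq ?_
      push_cast
      field_simp
  have hfin : ∫⁻ x in Set.Ioc a b, ∑' k, ENNReal.ofReal (v k x) ≠ ∞ := by
    rw [lintegral_tsum fun k => (hv k).measurable.ennreal_ofReal.aemeasurable]
    refine ne_top_of_le_ne_top ?_ (ENNReal.tsum_le_tsum hlin)
    exact ((Real.summable_one_div_nat_pow.2 one_lt_two).mul_left D).tsum_ofReal_ne_top
  filter_upwards [ae_lt_top' (AEMeasurable.tsum fun k =>
    (hv k).measurable.ennreal_ofReal.aemeasurable) hfin] with x hx
  have h0 := (ENNReal.tendsto_toReal ENNReal.zero_ne_top).comp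
    (ENNReal.tendsto_atTop_zero_of_tsum_ne_top hx.ne)
  refine tendsto_average_of_tendsto_average_sq (fun n => hu n x) ?_
  have h1 : Tendsto (fun k => v k x) atTop (𝓝 0) := by
    refine h0.congr fun k => ?_
    exact ENNReal.toReal_ofReal (sq_nonneg _)
  have h2 := h1.sqrt
  rw [Real.sqrt_zero] at h2
  exact (tendsto_zero_iff_abs_tendsto_zero _).2 (h2.congr fun k => Real.sqrt_sq_eq_abs _)

lemma HasBoundedJet.ae_tendsto_average {Q q r : ℝ → ℝ} {C : ℝ} (h : HasBoundedJet Q q r C) {α : ℝ}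
    (hα : 1 < |α|) : ∀ᵐ x : ℝ,
      Tendsto (fun N : ℕ => (∑ n ∈ Finset.range N, q (α ^ n * x)) / N) atTop (𝓝 0) := by
  have hqc := h.continuous
  have hk (k : ℕ) := (ae_restrict_iff' measurableSet_Ioc).1 <|
    ae_tendsto_average_of_integral_sum_sq_le (u := fun n x => q (α ^ n * x))
    (fun n => by fun_prop) (fun n x => h.abs_apply_le _) (a := -k) (b := k) (by simp)
    (h.integral_sum_sq_le hα (by simp))
  filter_upwards [ae_all_iff.2 hk] with x hx
  obtain ⟨k, hk⟩ := exists_nat_gt |x|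
  exact hx k ⟨(abs_lt.1 hk).1, (abs_lt.1 hk).2.le⟩

end StrongLaw

/-! ### The real-valued case. -/

section Approximation

lemma tendsto_average_of_approx {X : Type*} [NormedAddCommGroup X] [NormedSpace ℝ X] {s : ℕ → X}
    {m : X} (h : ∀ ε : ℝ, 0 < ε → ∃ (t : ℕ → X) (l : X), (∀ n, ‖s n - t n‖ ≤ ε) ∧ ‖m - l‖ ≤ ε ∧
      Tendsto (fun N : ℕ => (1 / (N : ℝ)) • ∑ n ∈ Finset.range N, t n) atTop (𝓝 l)) :
    Tendsto (fun N : ℕ => (1 / (N : ℝ)) • ∑ n ∈ Finset.range N, s n) atTop (𝓝 m) := by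
  refine Metric.tendsto_atTop'.2 fun ε hε => ?_
  obtain ⟨t, l, hst, hml, hl⟩ := h (ε / 4) (by positivity)
  obtain ⟨N₀, hN₀⟩ := Metric.tendsto_atTop'.1 hl (ε / 4) (by positivity)
  refine ⟨N₀, fun N hN => ?_⟩
  have hN0 : (0 : ℝ) < N := by exact_mod_cast (Nat.zero_le N₀).trans_lt hN
  have h1 : ‖(1 / (N : ℝ)) • ∑ n ∈ Finset.range N, s n - (1 / (N : ℝ)) • ∑ n ∈ Finset.range N, t n‖
      ≤ ε / 4 := by
    rw [← smul_sub, ← Finset.sum_sub_distrib, norm_smul, Real.norm_of_nonneg (by positivity)]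
    have := norm_sum_le_of_le (Finset.range N) fun n _ => hst n
    rw [Finset.sum_const, Finset.card_range, nsmul_eq_mul] at this
    rwa [one_div_mul_eq_div, div_le_iff₀' hN0]
  have h2 := hN₀ N hN
  rw [← dist_eq_norm] at h1 hml
  have h3 := dist_triangle4 ((1 / (N : ℝ)) • ∑ n ∈ Finset.range N, s n)
    ((1 / (N : ℝ)) • ∑ n ∈ Finset.range N, t n) l m
  rw [dist_comm l m] at h3
  linarith

/-- Take `q = A_d (f - A_T f)`: small `d` keeps `A_d f` near `f`, large `T` keeps `A_T f` near `m`.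
The outer average supplies the derivative. -/
lemma HasMean.exists_hasBoundedJet {f : ℝ → ℝ} {m : ℝ} (hm : HasMean f m)
    (hf : IsBohrAlmostPeriodic f) {ε : ℝ} (hε : 0 < ε) :
    ∃ (Q q r : ℝ → ℝ) (C : ℝ), HasBoundedJet Q q r C ∧ ∀ x, |f x - (m + q x)| ≤ ε := by
  obtain ⟨M, hM0, hM⟩ := hf.exists_norm_le
  obtain ⟨T, hT, hTm⟩ := ((eventually_gt_atTop (0 : ℝ)).and
    (Metric.tendstoUniformly_iff.1 hm.2 (ε / 2) (half_pos hε))).exists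
  obtain ⟨δ, hδ, hfδ⟩ := Metric.uniformContinuous_iff.1 hf.uniformContinuous (ε / 2) (half_pos hε)
  obtain ⟨F, hF⟩ := hf.1.exists_hasDerivAt
  have hc (T : ℝ) : Continuous (steklovAverage T f) :=
    continuous_of_forall_hasDerivAt fun x => hasDerivAt_steklovAverage hf.1 x
  have hd (T : ℝ) := hasDerivAt_steklovAverage_of_hasDerivAt (T := T) hf.1 hF
  have hδ2 := half_pos hδ
  have hTM := norm_steklovAverage_le hf.1 hT hM
  have hdδ := half_lt_self hδ
  set d := δ / 2
  have hfc := hf.1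
  have hTc := hc T
  refine ⟨fun x => steklovAverage d F x - steklovAverage d (steklovAverage T F) x,
    fun x => steklovAverage d f x - steklovAverage d (steklovAverage T f) x,
    fun x => (1 / (2 * d)) • (f (x + d) - f (x - d)) -
      (1 / (2 * d)) • (steklovAverage T f (x + d) - steklovAverage T f (x - d)),
    M * T + (M + M) + (M / d + M / d), ⟨?_, ?_, by fun_prop, ?_, ?_, ?_⟩, ?_⟩
  · exact fun x => (hd d x).sub (hasDerivAt_steklovAverage_of_hasDerivAt (hc T) (hd T) x)
  · exact fun x => (hasDerivAt_steklovAverage hf.1 x).sub (hasDerivAt_steklovAverage (hc T) x)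
  -- After commuting, the primitive is `G - A_T G` with `G = A_d F`, which is `M`-Lipschitz; hence
  -- the bound `M * T`, although `G` itself may be unbounded.
  · intro x
    have hcont := continuous_of_forall_hasDerivAt (hd d)
    rw [steklovAverage_comm (continuous_of_forall_hasDerivAt hF), abs_sub_comm]
    have : |steklovAverage T (steklovAverage d F) x - steklovAverage d F x| ≤ M * T := by
      refine norm_steklovAverage_sub_le hcont hT fun t ht => ?_
      have hb := Convex.norm_image_sub_le_of_norm_hasDerivWithin_le
        (fun y _ => (hd d y).hasDerivWithinAt)
        (fun y _ => norm_steklovAverage_le hf.1 hδ2 hM y) convex_univ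
        (Set.mem_univ x) (Set.mem_univ t)
      refine hb.trans ?_
      gcongr
      exact abs_le.2 ⟨by linarith [ht.1], by linarith [ht.2]⟩
    have : 0 ≤ M / d := by positivity
    linarith
  · intro x
    refine (norm_sub_le (_ : ℝ) _).trans ?_
    have h1 := norm_steklovAverage_le hf.1 hδ2 hM x
    have h2 := norm_steklovAverage_le (hc T) hδ2 hTM x
    have : 0 ≤ M / d := by positivity
    have : 0 ≤ M * T := by positivity
    linarith
  · intro x
    refine (norm_sub_le (_ : ℝ) _).trans ?_
    have h1 := norm_smul_sub_le hδ2 hM (x + d) (x - d)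
    have h2 := norm_smul_sub_le hδ2 hTM (x + d) (x - d)
    have : 0 ≤ M * T := by positivity
    linarith
  · intro x
    have h1 : |steklovAverage d f x - f x| ≤ ε / 2 := by
      refine norm_steklovAverage_sub_le hf.1 hδ2 fun t ht => (hfδ ?_).le
      exact abs_lt.2 ⟨by linarith [ht.1], by linarith [ht.2]⟩
    have h2 : |steklovAverage d (steklovAverage T f) x - m| ≤ ε / 2 := by
      refine norm_steklovAverage_sub_le (hc T) hδ2 fun t _ => ?_
      rw [norm_sub_rev]
      exact (hTm t).le
    have h1' := abs_le.1 h1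
    have h2' := abs_le.1 h2
    exact abs_le.2 ⟨by linarith [h1'.1, h1'.2, h2'.1, h2'.2],
      by linarith [h1'.1, h1'.2, h2'.1, h2'.2]⟩

theorem HasMean.ae_tendsto_average_real {f : ℝ → ℝ} {m : ℝ} (hm : HasMean f m)
    (hf : IsBohrAlmostPeriodic f) {α : ℝ} (hα : 1 < |α|) :
    ∀ᵐ x : ℝ, Tendsto (fun N : ℕ => (1 / (N : ℝ)) • ∑ n ∈ Finset.range N, f (α ^ n * x))
      atTop (𝓝 m) := by
  choose Q q r C hq hfq using fun k : ℕ =>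
    hm.exists_hasBoundedJet hf (Nat.one_div_pos_of_nat (n := k))
  filter_upwards [ae_all_iff.2 fun k => (hq k).ae_tendsto_average hα] with x hx
  refine tendsto_average_of_approx fun ε hε => ?_
  obtain ⟨k, hk⟩ := exists_nat_one_div_lt hε
  refine ⟨fun n => m + q k (α ^ n * x), m, fun n => (hfq k _).trans hk.le, by simpa using hε.le, ?_⟩
  have := (hx k).const_add m
  rw [add_zero] at this
  refine this.congr' ?_
  filter_upwards [eventually_gt_atTop 0] with N hN
  rw [Finset.sum_add_distrib, Finset.sum_const, Finset.card_range, nsmul_eq_mul, smul_eq_mul,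
    mul_add, one_div, inv_mul_cancel_left₀ (by positivity), inv_mul_eq_div]

end Approximation

/-! ### Reduction of the Banach-valued case to real coefficients. -/

section Vector

variable {X : Type*} [NormedAddCommGroup X] [NormedSpace ℝ X]

/-- A compact set in a normed space admits uniform approximations of the identity of finite rank,
with continuous coefficients. -/
lemma IsCompact.exists_finite_rank_approx {K : Set X} (hK : IsCompact K) {ε : ℝ} (hε : 0 < ε) :
    ∃ (t : Finset X) (φ : X → X → ℝ), (∀ c, Continuous (φ c)) ∧
      ∀ v ∈ K, ‖v - ∑ c ∈ t, φ c v • c‖ ≤ ε := by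
  obtain ⟨t, -, ht, hcov⟩ := hK.finite_cover_balls hε
  lift t to Finset X using ht
  obtain ⟨φ, hφ⟩ := PartitionOfUnity.exists_isSubordinate hK.isClosed
    (fun c : t => Metric.ball (c : X) ε) (fun _ => Metric.isOpen_ball) (by
      simpa [Set.iUnion_subtype] using hcov)
  classical
  refine ⟨t, fun c v => if h : c ∈ t then φ ⟨c, h⟩ v else 0, fun c => ?_, fun v hv => ?_⟩
  · by_cases h : c ∈ t
    · simpa [h] using (φ ⟨c, h⟩).continuous
    · simpa [h] using continuous_const
  · have hsum : ∑ c : t, φ c v = 1 := by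
      rw [← finsum_eq_sum_of_fintype]
      exact φ.sum_eq_one hv
    rw [← Finset.sum_coe_sort t]
    simp only [Finset.coe_mem, dif_pos, Subtype.coe_eta]
    have : v - ∑ c : t, φ c v • (c : X) = ∑ c : t, φ c v • (v - c) := by
      simp only [smul_sub, Finset.sum_sub_distrib, ← Finset.sum_smul, hsum, one_smul]
    rw [this]
    calc _ ≤ ∑ c : t, φ c v * ε := norm_sum_le_of_le _ fun c _ => by
          rw [norm_smul, Real.norm_of_nonneg (φ.nonneg c v)]
          by_cases h : φ c v = 0
          · simp [h]
          · refine mul_le_mul_of_nonneg_left ?_ (φ.nonneg c v)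
            have := hφ c (subset_tsupport _ (Function.mem_support.2 h))
            rw [Metric.mem_ball, dist_eq_norm] at this
            exact this.le
      _ = ε := by rw [← Finset.sum_mul, hsum, one_mul]

lemma HasMean.tendsto {f : ℝ → X} {m : X} (hm : HasMean f m) :
    Tendsto (fun T => steklovAverage T f 0) atTop (𝓝 m) :=
  hm.2.tendsto_at 0

/-- The coefficients `φ k c (f x)` are real almost periodic functions, and only countably many
occur, so one null set serves them all. -/
theorem HasMean.ae_tendsto_average [CompleteSpace X] {f : ℝ → X} {m : X} (hm : HasMean f m)
    (hf : IsBohrAlmostPeriodic f) {α : ℝ} (hα : 1 < |α|) :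
    ∀ᵐ x : ℝ, Tendsto (fun N : ℕ => (1 / (N : ℝ)) • ∑ n ∈ Finset.range N, f (α ^ n * x))
      atTop (𝓝 m) := by
  have hK : IsCompact (closure (Set.range f)) := 
    isCompact_iff_totallyBounded_isComplete.2
      ⟨hf.totallyBounded_range.closure, isClosed_closure.isComplete⟩
  choose t φ hφ hfφ using fun k : ℕ =>
    hK.exists_finite_rank_approx (Nat.one_div_pos_of_nat (n := k))
  have hap (k : ℕ) (c : X) : IsBohrAlmostPeriodic fun x => φ k c (f x) :=
    hf.comp ((hK.uniformContinuousOn_of_continuous (hφ k c).continuousOn).mono subset_closure)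
  choose μ hμ using fun k c => (hap k c).exists_hasMean
  have hae : ∀ᵐ x : ℝ, ∀ k, ∀ c ∈ t k, Tendsto (fun N : ℕ =>
      (1 / (N : ℝ)) • ∑ n ∈ Finset.range N, φ k c (f (α ^ n * x))) atTop (𝓝 (μ k c)) :=
    ae_all_iff.2 fun k => (ae_ball_iff (t k).countable_toSet).2 fun c _ =>
      (hμ k c).ae_tendsto_average_real (hap k c) hα
  -- Averaging does not increase the sup norm, so the error bound for the approximant passes to the
  -- means.
  have hmean (k : ℕ) : ‖m - ∑ c ∈ t k, μ k c • c‖ ≤ 1 / ((k : ℝ) + 1) := by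
    have hlim := (hm.tendsto.sub (tendsto_finsetSum (t k) fun c _ =>
      (hμ k c).tendsto.smul_const c)).norm
    refine le_of_tendsto hlim ?_
    filter_upwards [eventually_gt_atTop 0] with T hT
    have hs : Continuous fun x => ∑ c ∈ t k, φ k c (f x) • c :=
      continuous_finsetSum _ fun c _ => (hap k c).1.smul continuous_const
    have hi (c : X) : IntervalIntegrable (fun x => φ k c (f x) • c) volume (0 - T) (0 + T) :=
      ((hap k c).1.smul continuous_const).intervalIntegrable _ _
    have := norm_steklovAverage_le (hf.1.sub hs) hT (fun x => hfφ k _ (subset_closure ⟨x, rfl⟩)) 0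
    convert! this using 2
    simp only [steklovAverage, Pi.sub_apply]
    rw [intervalIntegral.integral_sub (hf.1.intervalIntegrable _ _)
      (hs.intervalIntegrable _ _),
      intervalIntegral.integral_finsetSum fun c _ => hi c, smul_sub, Finset.smul_sum]
    simp only [intervalIntegral.integral_smul_const, smul_assoc]
  filter_upwards [hae] with x hx
  refine tendsto_average_of_approx fun ε hε => ?_
  obtain ⟨k, hk⟩ := exists_nat_one_div_lt hε
  refine ⟨fun n => ∑ c ∈ t k, φ k c (f (α ^ n * x)) • c, ∑ c ∈ t k, μ k c • c,
    fun n => (hfφ k _ (subset_closure ⟨_, rfl⟩)).trans hk.le, (hmean k).trans hk.le, ?_⟩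
  refine (tendsto_finsetSum (t k) fun c hc => (hx k c hc).smul_const c).congr fun N => ?_
  rw [Finset.sum_comm, Finset.smul_sum]
  simp only [smul_assoc, Finset.sum_smul]

end Vector

theorem mainTheorem4 {X : Type*} [NormedAddCommGroup X] [NormedSpace ℝ X] [CompleteSpace X]
    (f : ℝ → X) (hf : IsBohrAlmostPeriodic f) :
    ∃ m : X, HasMean f m ∧
      ∀ α : ℝ, 1 < |α| →
        ∀ᵐ x : ℝ ∂volume,
          Tendsto (fun N : ℕ => (1 / (N : ℝ)) • ∑ n ∈ Finset.range N, f (α ^ n * x))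
            atTop (𝓝 m) := by
  obtain ⟨m, hm⟩ := hf.exists_hasMean
  exact ⟨m, hm, fun α hα => hm.ae_tendsto_average hf hα⟩
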